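/- Identify $\mathbb R^4$ with the quaternions $\mathbb H$. Let $\mathcal L$ be the space of lines of $\mathrm{PG}(3,\mathbb R)$ ($2$-dimensional subspaces of $\mathbb H$) and $\mathcal L^+$ the space of oriented lines, with their usual topologies. A topological spread (oriented spread) is a compact connected subset of $\mathcal L$ (of $\mathcal L^+$) such that every point of $\mathrm{PG}(3,\mathbb R)$ is incident with exactly one of its members. An ordinary (oriented) topological parallelism is a set $\Pi$ of topological spreads (oriented spreads) such that every element of $\mathcal L$ (of $\mathcal L^+$) belongs to exactly one member of $\Pi$, and such that $\Pi$ is compact in the hyperspace of compact subsets of $\mathcal L$ (of $\mathcal L^+$) with the Hausdorff topology. $\mathrm{Aut}\,\Pi$ is the group of all elements of $\mathrm{PGL}(4,\mathbb R)$ leaving $\Pi$ invariant. Let $\Lambda,\Upsilon\le \mathrm{PGL}(4,\mathbb R)$ be the groups induced by the maps $q\mapsto aq$ and $q\mapsto qb$, respectively, where $a,b\in\mathbb H$ have norm one; then $\mathrm{PSO}(4,\mathbb R)=\Lambda\times\Upsilon$ and $\Lambda\cong\Upsilon\cong\mathrm{SO}(3,\mathbb R)$. The left (right) Clifford parallelism,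 ordinary or oriented, is the set of orbits of $\Lambda$ (of $\Upsilon$) in $\mathcal L$ or in $\mathcal L^+$, respectively. The irreducible action of $\mathrm{SO}(3,\mathbb R)$ on $\mathrm{PG}(3,\mathbb R)$ is the action of $\Lambda$ or of $\Upsilon$, up to a change of coordinates $g\in\mathrm{PGL}(4,\mathbb R)$. **Theorem.** Let $\Pi$ be an ordinary or oriented topological parallelism of $\mathrm{PG}(3,\mathbb R)$ and let $g\in\mathrm{PGL}(4,\mathbb R)$. (a) If $g\Upsilon g^{-1}\le\mathrm{Aut}\,\Pi$, then either $g\Upsilon g^{-1}$ fixes every member of $\Pi$ and $\Pi$ is the image under $g$ of the (ordinary or oriented, respectively) right Clifford parallelism, or $g\Upsilon g^{-1}$ acts transitively on $\Pi$ and $\Pi$ is the image under $g$ of the left Clifford parallelism. (b) If $g\Lambda g^{-1}\le\mathrm{Aut}\,\Pi$, then either $g\Lambda g^{-1}$ fixes every member of $\Pi$ and $\Pi$ is the image under $g$ of the left Clifford parallelism, or $g\Lambda g^{-1}$ acts transitively on $\Pi$ and $\Pi$ is the image under $g$ of the right Clifford parallelism. In particular (take $g=1$), a topological parallelism admitting $\Lambda$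 or $\Upsilon$ is the left or the right Clifford parallelism. -/

import Mathlib

open scoped Quaternion Pointwise LinearAlgebra.Projectivization

noncomputable section

namespace RealParallelism

/-! ### Points, lines and oriented lines of `PG(3, ℝ)`

The 4-dimensional real vector space underlying `PG(3, ℝ)` is the quaternion algebra `ℍ[ℝ]`. -/

/-- The general linear group `GL(4, ℝ)`, acting on `ℝ⁴ = ℍ`. Nonzero scalars act trivially on lines
and (since they have positive determinant on every plane) on oriented lines, so that the actions
below are actions of `PGL(4, ℝ)`, written through representatives. -/
abbrev GL4 : Type := ℍ[ℝ] ≃ₗ[ℝ] ℍ[ℝ]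

/-- The points of `PG(3, ℝ)`. -/
abbrev Point : Type := ℙ ℝ ℍ[ℝ]

/-- The lines of `PG(3, ℝ)`: the 2-dimensional linear subspaces of `ℍ`. -/
def Line : Type := {L : Submodule ℝ ℍ[ℝ] // Module.finrank ℝ L = 2}

/-- The oriented lines of `PG(3, ℝ)`: the 2-dimensional linear subspaces of `ℍ` together with an
orientation. -/
structure OrientedLine : Type where
  line : Line
  orientation : Orientation ℝ line.1 (Fin 2)

/-- Linearly independent pairs of vectors in `ℍ`, with the subspace topology of `ℍ × ℍ`. -/
abbrev Frame : Type := {v : Fin 2 → ℍ[ℝ] // LinearIndependent ℝ v}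

/-- The line spanned by a linearly independent pair. -/
def Line.ofFrame (v : Frame) : Line :=
  ⟨Submodule.span ℝ (Set.range v.1), by rw [finrank_span_eq_card v.2]; simp⟩

/-- The line spanned by a linearly independent pair `(v₀, v₁)`, with the orientation for which
`(v₀, v₁)` is a positively oriented basis. -/
def OrientedLine.ofFrame (v : Frame) : OrientedLine :=
  ⟨Line.ofFrame v, (Module.Basis.span v.2).orientation⟩

/-- The usual (Grassmannian) topology of the line space: the quotient topology from frames. -/
instance : TopologicalSpace Line := TopologicalSpace.coinduced Line.ofFrame inferInstance

/-- The usual topology of the space of oriented lines: the quotient topology from frames. -/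
instance : TopologicalSpace OrientedLine :=
  TopologicalSpace.coinduced OrientedLine.ofFrame inferInstance

/-- Incidence of points and lines. -/
def Line.Incident (p : Point) (L : Line) : Prop := p.submodule ≤ L.1

/-- Incidence of points and oriented lines. -/
def OrientedLine.Incident (p : Point) (L : OrientedLine) : Prop := L.line.Incident p

/-! ### The action of the general linear group on lines and oriented lines -/

instance : MulAction GL4 Line where
  smul g L := ⟨L.1.map (g : ℍ[ℝ] →ₗ[ℝ] ℍ[ℝ]), by rw [LinearEquiv.finrank_map_eq]; exact L.2⟩
  one_smul L := Subtype.ext (Submodule.map_id L.1)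
  mul_smul g h L := Subtype.ext (Submodule.map_comp h.toLinearMap g.toLinearMap L.1)

theorem orientation_map_trans {M N P : Type*} [AddCommGroup M] [Module ℝ M] [AddCommGroup N]
    [Module ℝ N] [AddCommGroup P] [Module ℝ P] (e : M ≃ₗ[ℝ] N) (f : N ≃ₗ[ℝ] P)
    (o : Orientation ℝ M (Fin 2)) :
    Orientation.map (Fin 2) (e.trans f) o =
      Orientation.map (Fin 2) f (Orientation.map (Fin 2) e o) := by
  induction o using Module.Ray.ind with
  | h v hv => rfl

theorem OrientedLine.ext_map {L L' : OrientedLine} (h : L.line.1 = L'.line.1)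
    (ho : Orientation.map (Fin 2) (LinearEquiv.ofEq _ _ h) L.orientation = L'.orientation) :
    L = L' := by
  obtain ⟨⟨A, hA⟩, o⟩ := L
  obtain ⟨⟨B, hB⟩, o'⟩ := L'
  obtain rfl : A = B := h
  have : (LinearEquiv.ofEq A A rfl) = LinearEquiv.refl ℝ A := rfl
  simp only [this, Orientation.map_refl, Equiv.refl_apply] at ho
  rw [ho]

/-- A linear bijection maps an oriented line to its image, carrying the orientation along. -/
instance : MulAction GL4 OrientedLine where
  smul g L := ⟨g • L.line, Orientation.map (Fin 2) (g.submoduleMap L.line.1) L.orientation⟩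
  one_smul L := by
    refine OrientedLine.ext_map (Submodule.map_id L.line.1) ?_
    change Orientation.map (Fin 2) _ (Orientation.map (Fin 2) _ L.orientation) = _
    rw [← orientation_map_trans]
    exact DFunLike.congr_fun (Orientation.map_refl (Fin 2)) L.orientation
  mul_smul g h L := by
    refine OrientedLine.ext_map (Submodule.map_comp h.toLinearMap g.toLinearMap L.line.1) ?_
    change Orientation.map (Fin 2) _ (Orientation.map (Fin 2) _ L.orientation) =
      Orientation.map (Fin 2) _ (Orientation.map (Fin 2) _ L.orientation)
    rw [← orientation_map_trans, ← orientation_map_trans]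
    rfl

/-! ### Topological spreads and parallelisms

`X` stands for the space of lines or of oriented lines. -/

section Parallelism

variable {X : Type} [TopologicalSpace X]

/-- A topological (oriented) spread: a compact connected set of (oriented) lines such that each
point is incident with exactly one member. -/
def IsTopologicalSpread (Inc : Point → X → Prop) (C : Set X) : Prop :=
  IsCompact C ∧ IsConnected C ∧ ∀ p : Point, ∃! L : X, L ∈ C ∧ Inc p L

/-- A topological (oriented) parallelism: a set of topological (oriented) spreads such that every
(oriented) line belongs to exactly one of them, and which is compact in the hyperspace of compact
subsets of `X`. The topology of `Compacts X` is the Vietoris topology, that is, the one of the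
Hausdorff distance for any metric inducing the topology of `X`. -/
def IsTopologicalParallelism (Inc : Point → X → Prop) (P : Set (Set X)) : Prop :=
  (∀ C ∈ P, IsTopologicalSpread Inc C) ∧
  (∀ L : X, ∃! C : Set X, C ∈ P ∧ L ∈ C) ∧
  IsCompact {K : TopologicalSpace.Compacts X | (K : Set X) ∈ P}

end Parallelism

/-- Ordinary topological parallelisms of `PG(3, ℝ)`. -/
def IsOrdinaryParallelism (P : Set (Set Line)) : Prop :=
  IsTopologicalParallelism Line.Incident P

/-- Oriented topological parallelisms of `PG(3, ℝ)`. -/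
def IsOrientedParallelism (P : Set (Set OrientedLine)) : Prop :=
  IsTopologicalParallelism OrientedLine.Incident P

section Groups

variable {X : Type} [MulAction GL4 X]

/-- The automorphism group of a set `P` of sets of (oriented) lines (more precisely, its full
preimage in `GL(4, ℝ)`): all `g` with `g • P = P`, where `g • P = {g • C | C ∈ P}`. -/
def aut (P : Set (Set X)) : Subgroup GL4 := MulAction.stabilizer GL4 P

/-- The group `H` fixes every member of `P`. -/
def FixesClasses (H : Subgroup GL4) (P : Set (Set X)) : Prop :=
  ∀ h ∈ H, ∀ C ∈ P, h • C = C

/-- The group `H` is transitive on `P`. -/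
def TransitiveOnClasses (H : Subgroup GL4) (P : Set (Set X)) : Prop :=
  ∀ C ∈ P, ∀ D ∈ P, ∃ h ∈ H, h • C = D

end Groups

/-! ### The two factors of `PSO(4, ℝ)` and the Clifford parallelisms -/

/-- The group of all maps `q ↦ a * q` with `a` a quaternion of norm one. Its image in `PGL(4, ℝ)`
is the factor `Λ` of `PSO(4, ℝ)`. -/
def leftFactor : Subgroup GL4 where
  carrier := {g | ∃ a : ℍ[ℝ], ‖a‖ = 1 ∧ ∀ q, g q = a * q}
  one_mem' := ⟨1, norm_one, fun q => (one_mul q).symm⟩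
  mul_mem' := by
    rintro g h ⟨a, ha, hg⟩ ⟨b, hb, hh⟩
    exact ⟨a * b, by rw [norm_mul, ha, hb, one_mul], fun q => by
      rw [LinearEquiv.mul_apply, hh, hg, mul_assoc]⟩
  inv_mem' := by
    rintro g ⟨a, ha, hg⟩
    have h0 : a ≠ 0 := fun h => by simp [h] at ha
    refine ⟨a⁻¹, by rw [norm_inv, ha, inv_one], fun q => ?_⟩
    change g.symm q = _
    rw [LinearEquiv.symm_apply_eq, hg, mul_inv_cancel_left₀ h0]

/-- The group of all maps `q ↦ q * b` with `b` a quaternion of norm one. Its image in `PGL(4, ℝ)`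
is the factor `Υ` of `PSO(4, ℝ)`. -/
def rightFactor : Subgroup GL4 where
  carrier := {g | ∃ b : ℍ[ℝ], ‖b‖ = 1 ∧ ∀ q, g q = q * b}
  one_mem' := ⟨1, norm_one, fun q => (mul_one q).symm⟩
  mul_mem' := by
    rintro g h ⟨a, ha, hg⟩ ⟨b, hb, hh⟩
    exact ⟨b * a, by rw [norm_mul, ha, hb, one_mul], fun q => by
      rw [LinearEquiv.mul_apply, hh, hg, mul_assoc]⟩
  inv_mem' := by
    rintro g ⟨a, ha, hg⟩
    have h0 : a ≠ 0 := fun h => by simp [h] at ha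
    refine ⟨a⁻¹, by rw [norm_inv, ha, inv_one], fun q => ?_⟩
    change g.symm q = _
    rw [LinearEquiv.symm_apply_eq, hg, inv_mul_cancel_right₀ h0]

/-- The left Clifford parallelism (ordinary for `X = Line`, oriented for `X = OrientedLine`): the
set of orbits of the left factor. -/
def leftClifford (X : Type) [MulAction GL4 X] : Set (Set X) :=
  Set.range fun L : X => MulAction.orbit leftFactor L

/-- The right Clifford parallelism (ordinary for `X = Line`, oriented for `X = OrientedLine`): the
set of orbits of the right factor. -/
def rightClifford (X : Type) [MulAction GL4 X] : Set (Set X) :=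
  Set.range fun L : X => MulAction.orbit rightFactor L

end RealParallelism

end

open RealParallelism

/-!
An oriented line is determined by one of its nonzero vectors `q` and its *axis*, the imaginary unit
`b` for which `(q, q * b)` is a positively oriented orthogonal basis; the axis does not depend on
`q`. Left multiplications preserve axes and right multiplications conjugate them, so the orbits of
the left factor are the sets of all oriented lines with a given axis, and a right multiplication by
an element commuting with the axis of an oriented line fixes that line.

Let the right factor act on a parallelism. The stabilizer of a class contains the centralizer of the
axis of each of its members. If two of these axes do not commute, their centralizers generate the
whole right factor, and the class is one of its orbits. Otherwise all axes of the class are `± b`;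
the lines of the class can then be given the common axis `b`, in the oriented case because the axis
is continuous and the class is connected, so the class is an orbit of the left factor. The right
factor permutes these orbits transitively, so a single class of the second kind forces all classes
to be of that kind. Quaternion conjugation exchanges the two factors.
-/

noncomputable section

namespace RealParallelism

open scoped RealInnerProductSpace

theorem mul_self_eq_neg_one_iff {b : ℍ[ℝ]} : b * b = -1 ↔ b.re = 0 ∧ ‖b‖ = 1 := by
  constructor
  · intro hb
    have hnorm : ‖b‖ = 1 := by
      rw [← pow_eq_one_iff_of_nonneg (norm_nonneg b) two_ne_zero, sq, ← norm_mul, hb, norm_neg,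
        norm_one]
    refine ⟨Quaternion.sq_eq_neg_normSq.1 ?_, hnorm⟩
    rw [sq, hb, Quaternion.normSq_eq_norm_mul_self, hnorm, mul_one, Quaternion.coe_one]
  · rintro ⟨hre, hnorm⟩
    rw [← sq, Quaternion.sq_eq_neg_normSq.2 hre, Quaternion.normSq_eq_norm_mul_self, hnorm,
      mul_one, Quaternion.coe_one]

theorem ne_zero_of_mul_self_eq_neg_one {b : ℍ[ℝ]} (hb : b * b = -1) : b ≠ 0 := by
  rintro rfl
  simp at hb

theorem conj_mul_self_eq_neg_one {b r : ℍ[ℝ]} (hb : b * b = -1) (hr : r ≠ 0) :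
    (r⁻¹ * b * r) * (r⁻¹ * b * r) = -1 := by
  calc (r⁻¹ * b * r) * (r⁻¹ * b * r) = r⁻¹ * (b * (r * r⁻¹) * b) * r := by simp only [mul_assoc]
    _ = -1 := by rw [mul_inv_cancel₀ hr, mul_one, hb, mul_neg_one, neg_mul, inv_mul_cancel₀ hr]

theorem eq_or_eq_neg_of_commute {b c : ℍ[ℝ]} (hb : b * b = -1) (hc : c * c = -1)
    (h : Commute b c) : b = c ∨ b = -c :=
  h.sq_eq_sq_iff_eq_or_eq_neg.1 (by rw [sq, sq, hb, hc])

theorem mul_add_mul_eq_inner {x y : ℍ[ℝ]} (hx : x.re = 0) (hy : y.re = 0) :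
    x * y + y * x = ((-2 * ⟪x, y⟫ : ℝ) : ℍ[ℝ]) := by
  rw [Quaternion.inner_def, Quaternion.star_eq_neg.2 hy]
  ext <;> simp [hx, hy] <;> ring

theorem eq_inner_smul_of_commute {b x : ℍ[ℝ]} (hb : b * b = -1) (hx : x.re = 0)
    (h : Commute b x) : x = ⟪b, x⟫ • b := by
  have hbx : b * x = ((-⟪b, x⟫ : ℝ) : ℍ[ℝ]) := by
    refine smul_right_injective _ (two_ne_zero (α := ℝ)) ?_
    have hsum := mul_add_mul_eq_inner (mul_self_eq_neg_one_iff.1 hb).1 hx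
    rw [← h.eq, ← two_smul ℝ, neg_mul, ← mul_neg, ← Quaternion.smul_coe] at hsum
    exact hsum
  calc x = -(b * (b * x)) := by rw [← mul_assoc, hb, neg_one_mul, neg_neg]
    _ = ⟪b, x⟫ • b := by
      rw [hbx, Quaternion.mul_coe_eq_smul, neg_smul, neg_neg]

/-- The rotation of the imaginary space about `b` taking `x` to `y` is a product of two half-turns
about axes orthogonal to `b`. -/
theorem exists_commute_mul_eq_mul {b x y : ℍ[ℝ]} (hb : b * b = -1) (hx : x * x = -1)
    (hy : y * y = -1) (h : ⟪b, x⟫ = ⟪b, y⟫) : ∃ u ≠ 0, Commute u b ∧ u * x = y * u := by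
  rcases eq_or_ne x y with rfl | hxy
  · exact ⟨1, one_ne_zero, Commute.one_left b, by rw [one_mul, mul_one]⟩
  obtain ⟨hb0, hb1⟩ := mul_self_eq_neg_one_iff.1 hb
  obtain ⟨hx0, hx1⟩ := mul_self_eq_neg_one_iff.1 hx
  obtain ⟨hy0, hy1⟩ := mul_self_eq_neg_one_iff.1 hy
  have hby : ¬ Commute b y := by
    intro hcomm
    refine hxy ((inner_eq_one_iff_of_norm_eq_one (𝕜 := ℝ) hy1 hx1).1 ?_).symm
    rcases eq_or_eq_neg_of_commute hb hy hcomm with rfl | rfl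
    · rw [h, real_inner_self_eq_norm_sq, hb1, one_pow]
    · rw [inner_neg_left, inner_neg_left, neg_inj] at h
      rw [h, real_inner_self_eq_norm_sq, hy1, one_pow]
  have hbxy : (x - y) * b = -(b * (x - y)) := by
    have hsum := (mul_add_mul_eq_inner hb0 hx0).trans
      ((congrArg _ (congrArg _ h)).trans (mul_add_mul_eq_inner hb0 hy0).symm)
    rw [sub_mul, mul_sub, neg_sub, sub_eq_sub_iff_add_eq_add, add_comm, hsum]
  have hyxy : (x - y) * x = -(y * (x - y)) := by
    rw [sub_mul, mul_sub, hx, hy]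
    abel
  have hbw : (b * y - y * b) * b = -(b * (b * y - y * b)) := by
    rw [sub_mul, mul_sub, mul_assoc y, hb, ← mul_assoc b b, hb, mul_assoc]
    simp only [mul_neg, mul_one, neg_mul, one_mul]
    abel
  have hyw : (b * y - y * b) * y = -(y * (b * y - y * b)) := by
    rw [sub_mul, mul_sub, mul_assoc b, hy, ← mul_assoc y y, hy, mul_assoc]
    simp only [mul_neg, mul_one, neg_mul, one_mul]
    abel
  refine ⟨(b * y - y * b) * (x - y), mul_ne_zero (sub_ne_zero.2 hby) (sub_ne_zero.2 hxy), ?_, ?_⟩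
  · rw [Commute, SemiconjBy, mul_assoc, hbxy, mul_neg, ← mul_assoc, hbw, neg_mul, neg_neg,
      mul_assoc]
  · rw [mul_assoc, hyxy, mul_neg, ← mul_assoc, hyw, neg_mul, neg_neg, mul_assoc]

theorem exists_norm_eq_one_conj_eq {b c : ℍ[ℝ]} (hb : b * b = -1) (hc : c * c = -1) :
    ∃ r : ℍ[ℝ], ‖r‖ = 1 ∧ r⁻¹ * b * r = c := by
  obtain ⟨z, hz⟩ : ∃ z, b * z + z * c ≠ 0 := by
    by_contra! h
    have hcb : c = -b := by simpa [add_comm b, ← eq_neg_iff_add_eq_zero] using h 1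
    have hcomm (z : ℍ[ℝ]) : b * z = z * b := by
      simpa [hcb, ← sub_eq_add_neg, sub_eq_zero] using h z
    have hcoord (z : ℍ[ℝ]) : b.imJ * z.imK = b.imK * z.imJ ∧ b.imI * z.imJ = b.imJ * z.imI := by
      have h1 := congrArg (·.imI) (hcomm z)
      have h3 := congrArg (·.imK) (hcomm z)
      simp only [Quaternion.imI_mul, Quaternion.imK_mul] at h1 h3
      constructor <;> linarith
    refine ne_zero_of_mul_self_eq_neg_one hb ?_
    ext
    · exact (mul_self_eq_neg_one_iff.1 hb).1
    · simpa using (hcoord ⟨0, 0, 1, 0⟩).2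
    · simpa using (hcoord ⟨0, 0, 0, 1⟩).1
    · simpa using (hcoord ⟨0, 0, 1, 0⟩).1.symm
  set s := b * z + z * c with hs
  have hconj : b * s = s * c := by
    rw [hs, mul_add, add_mul, ← mul_assoc, hb, mul_assoc z, hc, mul_assoc, mul_neg_one,
      neg_one_mul, add_comm]
  refine ⟨NormedSpace.normalize s, NormedSpace.norm_normalize_eq_one_iff.2 hz, ?_⟩
  have hr : NormedSpace.normalize s ≠ 0 := (NormedSpace.normalize_eq_zero_iff s).not.2 hz
  rw [mul_assoc, inv_mul_eq_iff_eq_mul₀ hr, NormedSpace.normalize, mul_smul_comm, hconj,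
    smul_mul_assoc]

section Generation

variable {b c : ℍ[ℝ]} {K : Subgroup (Metric.sphere (0 : ℍ[ℝ]) 1)}

theorem inner_conj_le_one (hb : b * b = -1) (r : Metric.sphere (0 : ℍ[ℝ]) 1) :
    ⟪b, (r : ℍ[ℝ])⁻¹ * b * r⟫ ≤ 1 := by
  have hconj := conj_mul_self_eq_neg_one hb (ne_zero_of_mem_unit_sphere r)
  simpa only [(mul_self_eq_neg_one_iff.1 hb).2, (mul_self_eq_neg_one_iff.1 hconj).2, mul_one] using
    real_inner_le_norm b ((r : ℍ[ℝ])⁻¹ * b * r)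

theorem inner_conj_lt_one (hb : b * b = -1) (hc : c * c = -1) (hbc : ¬ Commute b c) :
    ⟪b, c⁻¹ * b * c⟫ < 1 := by
  have hc0 := ne_zero_of_mul_self_eq_neg_one hc
  refine (inner_lt_one_iff_real_of_norm_eq_one (mul_self_eq_neg_one_iff.1 hb).2
    (mul_self_eq_neg_one_iff.1 (conj_mul_self_eq_neg_one hb hc0)).2).2 fun h => hbc ?_
  rw [mul_assoc, eq_inv_mul_iff_mul_eq₀ hc0] at h
  exact h.symm

theorem mem_of_inner_conj_eq (hb : b * b = -1)
    (hKb : ∀ r : Metric.sphere (0 : ℍ[ℝ]) 1, Commute (r : ℍ[ℝ]) b → r ∈ K)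
    {r s : Metric.sphere (0 : ℍ[ℝ]) 1} (hs : s ∈ K)
    (h : ⟪b, (r : ℍ[ℝ])⁻¹ * b * r⟫ = ⟪b, (s : ℍ[ℝ])⁻¹ * b * s⟫) : r ∈ K := by
  have hr0 := ne_zero_of_mem_unit_sphere r
  have hs0 := ne_zero_of_mem_unit_sphere s
  obtain ⟨u, hu0, hub, hu⟩ := exists_commute_mul_eq_mul hb (conj_mul_self_eq_neg_one hb hr0)
    (conj_mul_self_eq_neg_one hb hs0) h
  let v : Metric.sphere (0 : ℍ[ℝ]) 1 := ⟨NormedSpace.normalize u,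
    mem_sphere_zero_iff_norm.2 (NormedSpace.norm_normalize_eq_one_iff.2 hu0)⟩
  have hvb : Commute (v : ℍ[ℝ]) b := hub.smul_left _
  have hv : (v : ℍ[ℝ]) * ((r : ℍ[ℝ])⁻¹ * b * r) = (s : ℍ[ℝ])⁻¹ * b * s * v := by
    simp only [v, NormedSpace.normalize, smul_mul_assoc, mul_smul_comm, hu]
  have hw : s * v * r⁻¹ ∈ K := by
    refine hKb _ ?_
    change (s : ℍ[ℝ]) * v * (r : ℍ[ℝ])⁻¹ * b = b * (s * v * (r : ℍ[ℝ])⁻¹)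
    calc (s : ℍ[ℝ]) * v * (r : ℍ[ℝ])⁻¹ * b
        = s * (v * ((r : ℍ[ℝ])⁻¹ * b * r)) * (r : ℍ[ℝ])⁻¹ := by
          simp only [mul_assoc, mul_inv_cancel₀ hr0, mul_one]
      _ = b * (s * v * (r : ℍ[ℝ])⁻¹) := by
          rw [hv]
          simp only [mul_assoc, mul_inv_cancel_left₀ hs0]
  have hr : r = (s * v * r⁻¹)⁻¹ * (s * v) := by group
  rw [hr]
  exact K.mul_mem (K.inv_mem hw) (K.mul_mem hs (hKb v hvb))

theorem mem_of_inner_conj_lt (hb : b * b = -1) (hc : c * c = -1)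
    (hKb : ∀ r : Metric.sphere (0 : ℍ[ℝ]) 1, Commute (r : ℍ[ℝ]) b → r ∈ K)
    (hKc : ∀ r : Metric.sphere (0 : ℍ[ℝ]) 1, Commute (r : ℍ[ℝ]) c → r ∈ K)
    {r : Metric.sphere (0 : ℍ[ℝ]) 1}
    (hr : ⟪b, c⁻¹ * b * c⟫ < ⟪b, (r : ℍ[ℝ])⁻¹ * b * r⟫) : r ∈ K := by
  let +nondep : NormedAlgebra ℚ ℍ[ℝ] := .restrictScalars ℚ ℝ ℍ[ℝ]
  obtain ⟨hc0, hc1⟩ := mul_self_eq_neg_one_iff.1 hc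
  have hexp (t : ℝ) : NormedSpace.exp (t • c) ∈ Metric.sphere (0 : ℍ[ℝ]) 1 := by
    simp [Quaternion.norm_exp, hc0]
  have hend : NormedSpace.exp ((Real.pi / 2) • c) = c := by
    rw [Quaternion.exp_of_re_eq_zero _ (by simp [hc0]), norm_smul, hc1, mul_one,
      Real.norm_of_nonneg (by positivity), Real.cos_pi_div_two, Real.sin_pi_div_two, smul_smul,
      one_div, inv_mul_cancel₀ (by positivity), one_smul, Quaternion.coe_zero, zero_add]
  have hcont : Continuous fun t : ℝ =>
      ⟪b, (NormedSpace.exp (t • c))⁻¹ * b * NormedSpace.exp (t • c)⟫ := by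
    have he : Continuous fun t : ℝ => NormedSpace.exp (t • c) :=
      NormedSpace.exp_continuous.comp (continuous_id.smul continuous_const)
    exact continuous_const.inner
      (((he.inv₀ fun t => ne_zero_of_mem_unit_sphere ⟨_, hexp t⟩).mul continuous_const).mul he)
  obtain ⟨t, -, ht⟩ := intermediate_value_Icc' (by positivity : (0 : ℝ) ≤ Real.pi / 2)
    hcont.continuousOn (show ⟪b, (r : ℍ[ℝ])⁻¹ * b * r⟫ ∈ Set.Icc _ _ from
      ⟨by rw [hend]; exact hr.le, by
        simpa [(mul_self_eq_neg_one_iff.1 hb).2] using inner_conj_le_one hb r⟩)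
  exact mem_of_inner_conj_eq hb hKb
    (hKc ⟨_, hexp t⟩ ((Commute.refl c).smul_left t).exp_left) ht.symm

/-- The union of the circles `C(b) s C(b)`, with `s` on the arc from `1` to `c` in `C(c)`, is a
neighbourhood of `1`. -/
theorem eq_top_of_centralizers_le (hb : b * b = -1) (hc : c * c = -1) (hbc : ¬ Commute b c)
    (hKb : ∀ r : Metric.sphere (0 : ℍ[ℝ]) 1, Commute (r : ℍ[ℝ]) b → r ∈ K)
    (hKc : ∀ r : Metric.sphere (0 : ℍ[ℝ]) 1, Commute (r : ℍ[ℝ]) c → r ∈ K) : K = ⊤ := by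
  have hcont : Continuous fun r : Metric.sphere (0 : ℍ[ℝ]) 1 => ⟪b, (r : ℍ[ℝ])⁻¹ * b * r⟫ :=
    continuous_const.inner (((continuous_subtype_val.inv₀ ne_zero_of_mem_unit_sphere).mul
      continuous_const).mul continuous_subtype_val)
  have hnhds : {r : Metric.sphere (0 : ℍ[ℝ]) 1 |
      ⟪b, c⁻¹ * b * c⟫ < ⟪b, (r : ℍ[ℝ])⁻¹ * b * r⟫} ∈ nhds 1 :=
    (isOpen_lt continuous_const hcont).mem_nhds (by
      simpa [(mul_self_eq_neg_one_iff.1 hb).2] using inner_conj_lt_one hb hc hbc)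
  have hopen : IsOpen (K : Set (Metric.sphere (0 : ℍ[ℝ]) 1)) :=
    K.isOpen_of_mem_nhds (Filter.mem_of_superset hnhds fun r hr =>
      mem_of_inner_conj_lt hb hc hKb hKc hr)
  have : PreconnectedSpace (Metric.sphere (0 : ℍ[ℝ]) 1) :=
    Subtype.preconnectedSpace (isPreconnected_sphere (by
      rw [← Module.finrank_eq_rank, Quaternion.finrank_eq_four]
      norm_num) 0 1)
  exact SetLike.coe_injective
    (IsClopen.eq_univ ⟨K.isClosed_of_isOpen hopen, hopen⟩ ⟨1, K.one_mem⟩)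

end Generation

theorem linearIndependent_pair_mul {q b : ℍ[ℝ]} (hq : q ≠ 0) (hb : b * b = -1) :
    LinearIndependent ℝ ![q, q * b] := by
  rw [LinearIndependent.pair_iff]
  intro s t h
  rw [← mul_one q, mul_assoc, one_mul, ← mul_smul_comm, ← mul_smul_comm, ← mul_add] at h
  have hst := (mul_eq_zero.1 h).resolve_left hq
  obtain rfl : s = 0 := by
    simpa [(mul_self_eq_neg_one_iff.1 hb).1] using congrArg QuaternionAlgebra.re hst
  rw [zero_smul, zero_add] at hst
  exact ⟨rfl, (smul_eq_zero.1 hst).resolve_right (ne_zero_of_mul_self_eq_neg_one hb)⟩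

section ImPairing

/-- The imaginary part of `x̄ y`. It is an alternating bilinear map, and its value at a basis of a
plane is one of the two halves (under `Λ²ℝ⁴ = ℝ³ ⊕ ℝ³`) of the Plücker coordinates. -/
def imPairing (x y : ℍ[ℝ]) : ℍ[ℝ] := (star x * y).im

theorem re_imPairing (x y : ℍ[ℝ]) : (imPairing x y).re = 0 := rfl

theorem imPairing_smul_add_smul (x y : ℍ[ℝ]) (s t s' t' : ℝ) :
    imPairing (s • x + t • y) (s' • x + t' • y) = (s * t' - t * s') • imPairing x y := by
  ext <;> simp [imPairing] <;> ring

theorem imPairing_swap (x y : ℍ[ℝ]) : imPairing y x = -imPairing x y := by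
  simpa using imPairing_smul_add_smul x y 0 1 1 0

theorem imPairing_neg_left (x y : ℍ[ℝ]) : imPairing (-x) y = -imPairing x y := by
  simpa using imPairing_smul_add_smul x y (-1) 0 0 1

theorem mul_imPairing (x y : ℍ[ℝ]) :
    x * imPairing x y = Quaternion.normSq x • y - (star x * y).re • x := by
  rw [imPairing, ← Quaternion.sub_re_self, mul_sub, ← mul_assoc, Quaternion.self_mul_star,
    Quaternion.coe_mul_eq_smul, Quaternion.mul_coe_eq_smul]

theorem imPairing_ne_zero {v : Fin 2 → ℍ[ℝ]} (hv : LinearIndependent ℝ v) :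
    imPairing (v 0) (v 1) ≠ 0 := by
  intro h
  have hrel := mul_imPairing (v 0) (v 1)
  rw [h, mul_zero, eq_comm, sub_eq_add_neg, add_comm, ← neg_smul] at hrel
  have hcoeff := Fintype.linearIndependent_iff.1 hv
    ![-(star (v 0) * v 1).re, Quaternion.normSq (v 0)] (by simpa [Fin.sum_univ_two] using hrel) 1
  exact hv.ne_zero 0 (Quaternion.normSq_eq_zero.1 hcoeff)

theorem imPairing_basis_ne_zero {A : Submodule ℝ ℍ[ℝ]} (e : Module.Basis (Fin 2) ℝ A) :
    imPairing (e 0) (e 1) ≠ 0 :=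
  imPairing_ne_zero (v := fun i => (e i : ℍ[ℝ]))
    (e.linearIndependent.map' A.subtype A.ker_subtype)

theorem imPairing_mul_left {a : ℍ[ℝ]} (ha : ‖a‖ = 1) (x y : ℍ[ℝ]) :
    imPairing (a * x) (a * y) = imPairing x y := by
  rw [imPairing, imPairing, star_mul, mul_assoc, ← mul_assoc (star a), Quaternion.star_mul_self,
    Quaternion.normSq_eq_norm_mul_self, ha, mul_one, Quaternion.coe_one, one_mul]

theorem imPairing_mul_right {r : ℍ[ℝ]} (hr : ‖r‖ = 1) (x y : ℍ[ℝ]) :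
    imPairing (x * r) (y * r) = r⁻¹ * imPairing x y * r := by
  have hconj : star r = r⁻¹ := by
    rw [Quaternion.inv_def, Quaternion.normSq_eq_norm_mul_self, hr, mul_one, inv_one, one_smul]
  have him (p : ℍ[ℝ]) : (star r * p * r).im = star r * p.im * r := by
    ext <;> simp <;> ring
  rw [imPairing, imPairing, star_mul, ← hconj, ← him]
  simp only [mul_assoc]

theorem continuous_imPairing : Continuous fun v : ℍ[ℝ] × ℍ[ℝ] => imPairing v.1 v.2 :=
  Quaternion.continuous_im.comp (continuous_fst.star.mul continuous_snd)

end ImPairing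

namespace OrientedLine

theorem normalize_imPairing_eq_of_orientation_eq {A : Submodule ℝ ℍ[ℝ]}
    (e f : Module.Basis (Fin 2) ℝ A) (h : e.orientation = f.orientation) :
    NormedSpace.normalize (imPairing (f 0) (f 1)) =
      NormedSpace.normalize (imPairing (e 0) (e 1)) := by
  have hdet : 0 < e.det f := (e.orientation_eq_iff_det_pos f).1 h
  rw [Module.Basis.det_apply, Matrix.det_fin_two] at hdet
  have hf (i : Fin 2) : (f i : ℍ[ℝ]) =
      e.toMatrix f 0 i • (e 0 : ℍ[ℝ]) + e.toMatrix f 1 i • (e 1 : ℍ[ℝ]) := by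
    have hsum := e.sum_toMatrix_smul_self f i
    rw [Fin.sum_univ_two] at hsum
    exact congrArg Subtype.val hsum.symm
  rw [hf 0, hf 1, imPairing_smul_add_smul, mul_comm (e.toMatrix f 1 0)]
  exact NormedSpace.normalize_smul_of_pos hdet _

/-- The axis of an oriented line: the imaginary unit `b` for which `(q, q * b)` is a positive basis
of the line, for every nonzero `q` on it. It parametrises the orbits of the left factor. -/
def axis (L : OrientedLine) : ℍ[ℝ] :=
  let e := L.orientation.someBasis (by rw [L.line.2, Fintype.card_fin])
  NormedSpace.normalize (imPairing (e 0) (e 1))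

/-- The span of a basis of a plane, with the orientation for which the basis is positive. -/
def ofBasis {A : Submodule ℝ ℍ[ℝ]} (e : Module.Basis (Fin 2) ℝ A) : OrientedLine :=
  ⟨⟨A, by rw [Module.finrank_eq_card_basis e, Fintype.card_fin]⟩, e.orientation⟩

/-- The line with the opposite orientation. -/
def reverse (L : OrientedLine) : OrientedLine := ⟨L.line, -L.orientation⟩

theorem axis_ofBasis {A : Submodule ℝ ℍ[ℝ]} (e : Module.Basis (Fin 2) ℝ A) :
    (ofBasis e).axis = NormedSpace.normalize (imPairing (e 0) (e 1)) :=
  normalize_imPairing_eq_of_orientation_eq _ _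
    ((ofBasis e).orientation.someBasis_orientation _).symm

theorem exists_eq_ofBasis (L : OrientedLine) :
    ∃ (A : Submodule ℝ ℍ[ℝ]) (e : Module.Basis (Fin 2) ℝ A), L = ofBasis e := by
  obtain ⟨⟨A, hA⟩, o⟩ := L
  have he := o.someBasis_orientation (by rw [hA, Fintype.card_fin])
  exact ⟨A, _, congrArg _ he.symm⟩

theorem smul_ofBasis (g : GL4) {A : Submodule ℝ ℍ[ℝ]} (e : Module.Basis (Fin 2) ℝ A) :
    g • ofBasis e = ofBasis (e.map (g.submoduleMap A)) :=
  congrArg (OrientedLine.mk _) (e.orientation_map (g.submoduleMap A)).symm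

theorem axis_mul_self (L : OrientedLine) : L.axis * L.axis = -1 := by
  obtain ⟨A, e, rfl⟩ := L.exists_eq_ofBasis
  rw [axis_ofBasis, mul_self_eq_neg_one_iff]
  exact ⟨by simp [NormedSpace.normalize, re_imPairing],
    NormedSpace.norm_normalize_eq_one_iff.2 (imPairing_basis_ne_zero e)⟩

theorem axis_ne_zero (L : OrientedLine) : L.axis ≠ 0 :=
  ne_zero_of_mul_self_eq_neg_one L.axis_mul_self

theorem mul_axis_mem {L : OrientedLine} {q : ℍ[ℝ]} (hq : q ∈ L.line.1) :
    q * L.axis ∈ L.line.1 := by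
  obtain ⟨A, e, rfl⟩ := L.exists_eq_ofBasis
  change q ∈ A at hq
  change q * (ofBasis e).axis ∈ A
  have h0 : (e 0 : ℍ[ℝ]) * imPairing (e 0) (e 1) ∈ A := by
    rw [mul_imPairing]
    exact sub_mem (A.smul_mem _ (e 1).2) (A.smul_mem _ (e 0).2)
  have h1 : (e 1 : ℍ[ℝ]) * imPairing (e 0) (e 1) ∈ A := by
    rw [imPairing_swap, mul_neg, mul_imPairing]
    exact neg_mem (sub_mem (A.smul_mem _ (e 0).2) (A.smul_mem _ (e 1).2))
  have hsum := congrArg Subtype.val (e.sum_repr ⟨q, hq⟩)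
  simp only [Fin.sum_univ_two, Submodule.coe_add, Submodule.coe_smul] at hsum
  rw [axis_ofBasis, NormedSpace.normalize, mul_smul_comm, ← hsum, add_mul, smul_mul_assoc,
    smul_mul_assoc]
  exact A.smul_mem _ (add_mem (A.smul_mem _ h0) (A.smul_mem _ h1))

theorem exists_mem_ne_zero (L : OrientedLine) : ∃ q ∈ L.line.1, q ≠ 0 := by
  obtain ⟨A, e, rfl⟩ := L.exists_eq_ofBasis
  exact ⟨e 0, (e 0).2, fun h => e.ne_zero 0 (Subtype.ext h)⟩

theorem axis_reverse (L : OrientedLine) : L.reverse.axis = -L.axis := by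
  obtain ⟨A, e, rfl⟩ := L.exists_eq_ofBasis
  have hrev : (ofBasis e).reverse = ofBasis (e.unitsSMul (Function.update 1 0 (-1))) :=
    congrArg (OrientedLine.mk _) (e.orientation_neg_single 0).symm
  rw [hrev, axis_ofBasis, axis_ofBasis, ← NormedSpace.normalize_neg, ← imPairing_neg_left,
    Module.Basis.unitsSMul_apply, Module.Basis.unitsSMul_apply]
  simp

theorem axis_smul {g : GL4} {u v : ℍ[ℝ]} (huv : ‖u‖ * ‖v‖ = 1)
    (hg : ∀ x y, imPairing (g x) (g y) = u * imPairing x y * v) (L : OrientedLine) :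
    (g • L).axis = u * L.axis * v := by
  obtain ⟨A, e, rfl⟩ := L.exists_eq_ofBasis
  have hnorm : ‖u * imPairing (e 0) (e 1) * v‖ = ‖imPairing (e 0) (e 1)‖ := by
    rw [norm_mul, norm_mul, mul_right_comm, huv, one_mul]
  rw [smul_ofBasis, axis_ofBasis, axis_ofBasis, Module.Basis.map_apply, Module.Basis.map_apply,
    LinearEquiv.submoduleMap_apply, LinearEquiv.submoduleMap_apply, hg, NormedSpace.normalize,
    NormedSpace.normalize, hnorm, mul_smul_comm, smul_mul_assoc]

theorem axis_smul_of_mem_leftFactor {h : GL4} (hh : h ∈ leftFactor) (L : OrientedLine) :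
    (h • L).axis = L.axis := by
  obtain ⟨a, ha, hmul⟩ := hh
  have hpair (x y : ℍ[ℝ]) : imPairing (h x) (h y) = 1 * imPairing x y * 1 := by
    rw [hmul, hmul, imPairing_mul_left ha, one_mul, mul_one]
  simpa using axis_smul (by simp) hpair L

theorem axis_smul_of_forall_eq_mul {h : GL4} {r : ℍ[ℝ]} (hr : ‖r‖ = 1) (hh : ∀ q, h q = q * r)
    (L : OrientedLine) : (h • L).axis = r⁻¹ * L.axis * r :=
  axis_smul (by rw [norm_inv, hr, inv_one, one_mul])
    (fun x y => by rw [hh, hh, imPairing_mul_right hr]) L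

theorem axis_ofFrame (v : Frame) :
    (ofFrame v).axis = NormedSpace.normalize (imPairing (v.1 0) (v.1 1)) := by
  rw [show ofFrame v = ofBasis (Module.Basis.span v.2) from rfl, axis_ofBasis,
    Module.Basis.span_apply, Module.Basis.span_apply]

theorem continuous_axis : Continuous axis := by
  refine continuous_coinduced_dom.2 ?_
  have hcont : Continuous fun v : Frame => imPairing (v.1 0) (v.1 1) :=
    continuous_imPairing.comp₂ ((continuous_apply 0).comp continuous_subtype_val)
      ((continuous_apply 1).comp continuous_subtype_val)
  exact ((hcont.norm.inv₀ fun v => norm_ne_zero_iff.2 (imPairing_ne_zero v.2)).smul hcont).congr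
    fun v => (axis_ofFrame v).symm

theorem line_eq_span {L : OrientedLine} {q : ℍ[ℝ]} (hq : q ≠ 0) (hqL : q ∈ L.line.1) :
    L.line.1 = Submodule.span ℝ (Set.range ![q, q * L.axis]) := by
  symm
  refine Submodule.eq_of_le_of_finrank_eq ?_ ?_
  · rw [Submodule.span_le, Set.range_subset_iff, Fin.forall_fin_two]
    exact ⟨hqL, mul_axis_mem hqL⟩
  · rw [finrank_span_eq_card (linearIndependent_pair_mul hq L.axis_mul_self), L.line.2,
      Fintype.card_fin]

theorem eq_or_eq_reverse {L N : OrientedLine} (h : L.line = N.line) : L = N ∨ L = N.reverse := by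
  obtain ⟨l, o⟩ := L
  obtain ⟨n, o'⟩ := N
  obtain rfl : l = n := h
  rcases o.eq_or_eq_neg o' (by rw [l.2, Fintype.card_fin]) with rfl | rfl
  · exact Or.inl rfl
  · exact Or.inr rfl

theorem eq_of_axis_eq {L N : OrientedLine} {q : ℍ[ℝ]} (hq : q ≠ 0) (hqL : q ∈ L.line.1)
    (hqN : q ∈ N.line.1) (h : L.axis = N.axis) : L = N := by
  have hline : L.line = N.line :=
    Subtype.ext (by rw [line_eq_span hq hqL, line_eq_span hq hqN, h])
  refine (eq_or_eq_reverse hline).resolve_right fun hrev => ?_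
  have : IsAddTorsionFree ℍ[ℝ] := .of_module_rat _
  rw [hrev, axis_reverse, neg_eq_self] at h
  exact N.axis_ne_zero h

theorem continuous_smul (g : GL4) : Continuous fun L : OrientedLine => g • L := by
  refine continuous_coinduced_dom.2 ?_
  let image : Frame → Frame := fun v => ⟨g ∘ v.1, v.2.map' g.toLinearMap g.ker⟩
  have himage : Continuous image :=
    Continuous.subtype_mk (continuous_pi fun i =>
      g.toLinearMap.continuous_of_finiteDimensional.comp
        ((continuous_apply i).comp continuous_subtype_val)) _
  have hsmul (v : Frame) : g • ofFrame v = ofFrame (image v) := by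
    have hmem (w : Frame) : w.1 0 ∈ (ofFrame w).line.1 := Submodule.subset_span ⟨0, rfl⟩
    refine eq_of_axis_eq ((image v).2.ne_zero 0) ⟨_, hmem v, rfl⟩ (hmem _) ?_
    rw [show ofFrame v = ofBasis (Module.Basis.span v.2) from rfl, smul_ofBasis, axis_ofBasis,
      axis_ofFrame, Module.Basis.map_apply, Module.Basis.map_apply,
      LinearEquiv.submoduleMap_apply, LinearEquiv.submoduleMap_apply, Module.Basis.span_apply,
      Module.Basis.span_apply]
    rfl
  exact (continuous_coinduced_rng.comp himage).congr fun v => (hsmul v).symm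

theorem mul_mem_of_commute {L : OrientedLine} {q u : ℍ[ℝ]} (hq : q ∈ L.line.1)
    (hu : Commute L.axis u) : q * u ∈ L.line.1 := by
  have him : Commute L.axis u.im := by
    rw [← Quaternion.sub_re_self]
    exact hu.sub_right (Quaternion.coe_commutes _ _).symm
  rw [← Quaternion.re_add_im u, eq_inner_smul_of_commute L.axis_mul_self (Quaternion.re_im u) him,
    mul_add, Quaternion.mul_coe_eq_smul, mul_smul_comm]
  exact add_mem (L.line.1.smul_mem _ hq) (L.line.1.smul_mem _ (mul_axis_mem hq))

theorem axis_eq_of_isPreconnected {C : Set OrientedLine} (hC : IsPreconnected C)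
    (hcomm : ∀ L ∈ C, ∀ N ∈ C, Commute L.axis N.axis) {L N : OrientedLine} (hL : L ∈ C)
    (hN : N ∈ C) : N.axis = L.axis := by
  by_contra hne
  have hfinite : (axis '' C).Finite := by
    refine (Set.toFinite {L.axis, -L.axis}).subset ?_
    rintro _ ⟨M, hM, rfl⟩
    exact eq_or_eq_neg_of_commute M.axis_mul_self L.axis_mul_self (hcomm M hM L hL)
  exact (hC.image axis continuous_axis.continuousOn).infinite_of_nontrivial
    ⟨_, Set.mem_image_of_mem _ hN, _, Set.mem_image_of_mem _ hL, hne⟩ hfinite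

end OrientedLine

/-- Right multiplication by the inverse of a unit quaternion, as a homomorphism. -/
def rightMulHom : Metric.sphere (0 : ℍ[ℝ]) 1 →* GL4 where
  toFun r :=
    { toFun := fun q => q * (r : ℍ[ℝ])⁻¹
      invFun := fun q => q * (r : ℍ[ℝ])
      map_add' := fun x y => add_mul x y _
      map_smul' := fun s x => smul_mul_assoc s x _
      left_inv := fun x => inv_mul_cancel_right₀ (ne_zero_of_mem_unit_sphere r) x
      right_inv := fun x => mul_inv_cancel_right₀ (ne_zero_of_mem_unit_sphere r) x }
  map_one' := LinearEquiv.ext fun x => by simp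
  map_mul' r s := LinearEquiv.ext fun x => by simp [mul_assoc]

theorem rightMulHom_apply (r : Metric.sphere (0 : ℍ[ℝ]) 1) (q : ℍ[ℝ]) :
    rightMulHom r q = q * (r : ℍ[ℝ])⁻¹ := rfl

theorem exists_rightMulHom_apply_eq {b : ℍ[ℝ]} (hb : ‖b‖ = 1) :
    ∃ r, ∀ q, rightMulHom r q = q * b :=
  ⟨⟨b⁻¹, by simp [hb]⟩, fun q => by simp [rightMulHom_apply]⟩

theorem range_rightMulHom : rightMulHom.range = rightFactor := by
  ext h
  constructor
  · rintro ⟨r, rfl⟩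
    exact ⟨(r : ℍ[ℝ])⁻¹, by simp, rightMulHom_apply r⟩
  · rintro ⟨b, hb, hmul⟩
    obtain ⟨r, hr⟩ := exists_rightMulHom_apply_eq hb
    exact ⟨r, LinearEquiv.ext fun q => (hr q).trans (hmul q).symm⟩

theorem exists_mem_rightFactor {b : ℍ[ℝ]} (hb : ‖b‖ = 1) :
    ∃ h ∈ rightFactor, ∀ q, h q = q * b := by
  obtain ⟨r, hr⟩ := exists_rightMulHom_apply_eq hb
  exact ⟨_, range_rightMulHom ▸ ⟨r, rfl⟩, hr⟩

theorem rightMulHom_smul_eq_self {r : Metric.sphere (0 : ℍ[ℝ]) 1} {L : OrientedLine}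
    (h : Commute (r : ℍ[ℝ]) L.axis) : rightMulHom r • L = L := by
  obtain ⟨q, hqL, hq⟩ := L.exists_mem_ne_zero
  have hr0 := ne_zero_of_mem_unit_sphere r
  refine OrientedLine.eq_of_axis_eq (mul_ne_zero hq (inv_ne_zero hr0)) ⟨q, hqL, rfl⟩
    (OrientedLine.mul_mem_of_commute hqL h.symm.inv_right₀) ?_
  rw [OrientedLine.axis_smul_of_forall_eq_mul (by simp) (rightMulHom_apply r), inv_inv, h.eq,
    mul_inv_cancel_right₀ hr0]

/-- Quaternion conjugation; it interchanges left and right multiplications. -/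
def starEquiv : GL4 where
  toFun := star
  invFun := star
  map_add' := star_add
  map_smul' := Quaternion.star_smul
  left_inv := star_star
  right_inv := star_star

theorem starEquiv_apply (q : ℍ[ℝ]) : starEquiv q = star q := rfl

theorem starEquiv_inv : starEquiv⁻¹ = starEquiv :=
  inv_eq_of_mul_eq_one_left (LinearEquiv.ext star_star)

theorem conj_starEquiv_smul_rightFactor : MulAut.conj starEquiv • rightFactor = leftFactor := by
  ext h
  rw [Subgroup.mem_pointwise_smul_iff_inv_smul_mem, ← map_inv, MulAut.smul_def,
    MulAut.conj_apply, inv_inv, starEquiv_inv]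
  constructor
  · rintro ⟨b, hb, hmul⟩
    refine ⟨star b, by rwa [norm_star], fun q => ?_⟩
    have hq := congrArg star (hmul (star q))
    rwa [LinearEquiv.mul_apply, LinearEquiv.mul_apply, starEquiv_apply, starEquiv_apply,
      star_star, star_star, star_mul, star_star] at hq
  · rintro ⟨a, ha, hmul⟩
    refine ⟨star a, by rwa [norm_star], fun q => ?_⟩
    rw [LinearEquiv.mul_apply, LinearEquiv.mul_apply, starEquiv_apply, starEquiv_apply, hmul,
      star_mul, star_star]

theorem exists_mem_rightFactor_smul_eq (p p' : Point) : ∃ h ∈ rightFactor, h • p = p' := by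
  induction p using Projectivization.ind with | h q hq
  induction p' using Projectivization.ind with | h q' hq'
  have hr : q⁻¹ * q' ≠ 0 := mul_ne_zero (inv_ne_zero hq) hq'
  obtain ⟨h, hh, hmul⟩ :=
    exists_mem_rightFactor (NormedSpace.norm_normalize_eq_one_iff.2 hr)
  refine ⟨h, hh, ?_⟩
  rw [Projectivization.smul_mk, Projectivization.mk_eq_mk_iff']
  refine ⟨‖q⁻¹ * q'‖⁻¹, ?_⟩
  change _ = h q
  rw [hmul, NormedSpace.normalize, mul_smul_comm, mul_inv_cancel_left₀ hq]

theorem exists_mem_leftFactor_smul_eq (p p' : Point) : ∃ h ∈ leftFactor, h • p = p' := by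
  obtain ⟨h, hh, hp⟩ :=
    exists_mem_rightFactor_smul_eq (starEquiv⁻¹ • p) (starEquiv⁻¹ • p')
  refine ⟨MulAut.conj starEquiv h, ?_, ?_⟩
  · rw [← conj_starEquiv_smul_rightFactor]
    exact Subgroup.smul_mem_pointwise_smul _ _ _ hh
  · rw [MulAut.conj_apply, mul_smul, mul_smul, hp, smul_inv_smul]

theorem Line.incident_mk_iff {q : ℍ[ℝ]} (hq : q ≠ 0) (L : Line) :
    Line.Incident (Projectivization.mk ℝ q hq) L ↔ q ∈ L.1 := by
  rw [Line.Incident, Projectivization.submodule_mk, Submodule.span_singleton_le_iff_mem]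

theorem Line.incident_smul_iff (g : GL4) (p : Point) (L : Line) :
    Line.Incident (g • p) (g • L) ↔ Line.Incident p L := by
  induction p using Projectivization.ind with | h q hq
  rw [Projectivization.smul_mk, Line.incident_mk_iff, Line.incident_mk_iff]
  exact g.injective.mem_set_image

theorem OrientedLine.eq_of_axis_eq_of_incident {L N : OrientedLine} {p : Point}
    (hL : OrientedLine.Incident p L) (hN : OrientedLine.Incident p N) (h : L.axis = N.axis) :
    L = N := by
  induction p using Projectivization.ind with | h q hq
  exact eq_of_axis_eq hq ((Line.incident_mk_iff hq _).1 hL) ((Line.incident_mk_iff hq _).1 hN) h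

theorem OrientedLine.exists_incident (L : OrientedLine) : ∃ p, OrientedLine.Incident p L := by
  obtain ⟨q, hqL, hq⟩ := L.exists_mem_ne_zero
  exact ⟨Projectivization.mk ℝ q hq, (Line.incident_mk_iff hq _).2 hqL⟩

theorem OrientedLine.exists_mem_rightFactor_axis_smul_eq (L N : OrientedLine) :
    ∃ h ∈ rightFactor, (h • L).axis = N.axis := by
  obtain ⟨r, hr, hconj⟩ := exists_norm_eq_one_conj_eq L.axis_mul_self N.axis_mul_self
  obtain ⟨h, hh, hmul⟩ := exists_mem_rightFactor hr
  exact ⟨h, hh, by rw [axis_smul_of_forall_eq_mul hr hmul, hconj]⟩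

/-- The common features of the spaces of lines and of oriented lines: a quotient of the space of
oriented lines to which incidence and the action of `GL4` descend. -/
structure IsLineQuotient {X : Type*} [MulAction GL4 X] (Inc : Point → X → Prop)
    (π : OrientedLine → X) : Prop where
  surjective : Function.Surjective π
  map_smul : ∀ (g : GL4) (L : OrientedLine), π (g • L) = g • π L
  incident_iff : ∀ (p : Point) (L : OrientedLine), Inc p (π L) ↔ OrientedLine.Incident p L

theorem isLineQuotient_id : IsLineQuotient OrientedLine.Incident id where
  surjective := Function.surjective_id
  map_smul _ _ := rfl
  incident_iff _ _ := Iff.rfl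

theorem isLineQuotient_line : IsLineQuotient Line.Incident OrientedLine.line where
  surjective L := ⟨⟨L, (Module.finBasisOfFinrankEq ℝ L.1 L.2).orientation⟩, rfl⟩
  map_smul _ _ := rfl
  incident_iff _ _ := Iff.rfl

/-- A set of (oriented) lines covering every point exactly once: a spread, without any topological
condition. -/
def IsSpread {X : Type*} (Inc : Point → X → Prop) (C : Set X) : Prop :=
  ∀ p, ∃! x, x ∈ C ∧ Inc p x

/-- A partition of the set of (oriented) lines into spreads: a parallelism, without any topological
condition. -/
structure IsParallelism {X : Type*} (Inc : Point → X → Prop) (P : Set (Set X)) : Prop where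
  isSpread : ∀ C ∈ P, IsSpread Inc C
  existsUnique_mem : ∀ x, ∃! C, C ∈ P ∧ x ∈ C

theorem IsTopologicalParallelism.isParallelism {X : Type} [TopologicalSpace X]
    {Inc : Point → X → Prop} {P : Set (Set X)} (hP : IsTopologicalParallelism Inc P) :
    IsParallelism Inc P :=
  ⟨fun C hC => (hP.1 C hC).2.2, hP.2.1⟩

theorem IsParallelism.eq_of_mem {X : Type*} {Inc : Point → X → Prop} {P : Set (Set X)}
    (hP : IsParallelism Inc P) {C D : Set X} (hC : C ∈ P) (hD : D ∈ P) {x : X} (hxC : x ∈ C)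
    (hxD : x ∈ D) : C = D :=
  (hP.existsUnique_mem x).unique ⟨hC, hxC⟩ ⟨hD, hxD⟩

theorem eq_of_subset_of_existsUnique {α β : Type*} {R : α → β → Prop} {S T : Set β} (hST : S ⊆ T)
    (hR : ∀ b ∈ T, ∃ a, R a b) (hS : ∀ a, ∃ b ∈ S, R a b) (hT : ∀ a, ∃! b, b ∈ T ∧ R a b) :
    S = T := by
  refine hST.antisymm fun b hb => ?_
  obtain ⟨a, hab⟩ := hR b hb
  obtain ⟨b', hb', hab'⟩ := hS a
  rwa [(hT a).unique ⟨hb, hab⟩ ⟨hST hb', hab'⟩]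

theorem existsUnique_mem_smul_set_iff {G α : Type*} [Group G] [MulAction G α] (g : G) (S : Set α)
    (p : α → Prop) : (∃! x, x ∈ g • S ∧ p x) ↔ ∃! x, x ∈ S ∧ p (g • x) := by
  refine ((MulAction.toPerm g).existsUnique_congr fun x => ?_).symm
  exact and_congr_left' Set.smul_mem_smul_set_iff.symm

section GroupActions

variable {X : Type} [MulAction GL4 X] {H : Subgroup GL4} {P : Set (Set X)}

theorem FixesClasses.smul (hP : FixesClasses H P) (g : GL4) :
    FixesClasses (MulAut.conj g • H) (g • P) := by
  rintro _ ⟨h, hh, rfl⟩ _ ⟨C, hC, rfl⟩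
  change (g * h * g⁻¹) • g • C = g • C
  rw [smul_smul, inv_mul_cancel_right, mul_smul, hP h hh C hC]

theorem TransitiveOnClasses.smul (hP : TransitiveOnClasses H P) (g : GL4) :
    TransitiveOnClasses (MulAut.conj g • H) (g • P) := by
  rintro _ ⟨C, hC, rfl⟩ _ ⟨D, hD, rfl⟩
  obtain ⟨h, hh, rfl⟩ := hP C hC D hD
  refine ⟨_, Subgroup.smul_mem_pointwise_smul h (MulAut.conj g) H hh, ?_⟩
  change (g * h * g⁻¹) • g • C = g • h • C
  rw [smul_smul, inv_mul_cancel_right, mul_smul]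

theorem smul_orbit_subgroup (g : GL4) (H : Subgroup GL4) (x : X) :
    g • MulAction.orbit H x = MulAction.orbit (MulAut.conj g • H : Subgroup GL4) (g • x) := by
  have hconj (h : GL4) : (g * h * g⁻¹) • g • x = g • h • x := by
    rw [smul_smul, inv_mul_cancel_right, mul_smul]
  ext y
  constructor
  · rintro ⟨_, ⟨⟨h, hh⟩, rfl⟩, rfl⟩
    exact ⟨⟨_, Subgroup.smul_mem_pointwise_smul h (MulAut.conj g) H hh⟩, hconj h⟩
  · rintro ⟨⟨_, h, hh, rfl⟩, rfl⟩
    exact ⟨_, ⟨⟨h, hh⟩, rfl⟩, (hconj h).symm⟩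

theorem smul_range_orbit_subgroup (g : GL4) (H : Subgroup GL4) :
    g • (Set.range fun x : X => MulAction.orbit H x) =
      Set.range fun x : X => MulAction.orbit (MulAut.conj g • H : Subgroup GL4) x := by
  rw [Set.smul_set_range, ← (MulAction.surjective g).range_comp fun x => MulAction.orbit _ x]
  exact congrArg Set.range (funext (smul_orbit_subgroup g H))

theorem starEquiv_smul_rightClifford (X : Type) [MulAction GL4 X] :
    starEquiv • rightClifford X = leftClifford X := by
  rw [rightClifford, smul_range_orbit_subgroup, conj_starEquiv_smul_rightFactor, leftClifford]

theorem starEquiv_smul_leftClifford (X : Type) [MulAction GL4 X] :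
    starEquiv • leftClifford X = rightClifford X := by
  rw [← starEquiv_smul_rightClifford, ← eq_inv_smul_iff, starEquiv_inv]

theorem fixesClasses_rightClifford (X : Type) [MulAction GL4 X] :
    FixesClasses rightFactor (rightClifford X) := by
  rintro h hh _ ⟨x, rfl⟩
  exact MulAction.smul_orbit (⟨h, hh⟩ : rightFactor) x

theorem conj_smul_leftFactor {h : GL4} (hh : h ∈ rightFactor) :
    MulAut.conj h • leftFactor = leftFactor := by
  refine Subgroup.mem_normalizer_iff_map_conj_eq.1 (Subgroup.centralizer_le_normalizer _ ?_)
  rintro k ⟨a, -, hk⟩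
  obtain ⟨b, -, hh⟩ := hh
  exact LinearEquiv.ext fun q => by
    rw [LinearEquiv.mul_apply, LinearEquiv.mul_apply, hk, hk, hh, hh, mul_assoc]

theorem smul_orbit_leftFactor {h : GL4} (hh : h ∈ rightFactor) (x : X) :
    h • MulAction.orbit leftFactor x = MulAction.orbit leftFactor (h • x) := by
  rw [smul_orbit_subgroup, conj_smul_leftFactor hh]

theorem smul_mem_of_le_aut (hH : H ≤ aut P) {h : GL4} (hh : h ∈ H) {C : Set X} (hC : C ∈ P) :
    h • C ∈ P :=
  (show h • P = P from hH hh) ▸ Set.smul_mem_smul_set hC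

theorem le_aut_inv_smul {g : GL4} (hH : MulAut.conj g • H ≤ aut P) : H ≤ aut (g⁻¹ • P) := by
  rw [aut, MulAction.stabilizer_smul_eq_stabilizer_map_conj, map_inv]
  change H ≤ (MulAut.conj g)⁻¹ • aut P
  rwa [Subgroup.subset_pointwise_smul_iff, inv_inv]

end GroupActions

section Classification

variable {X : Type} [MulAction GL4 X] {Inc : Point → X → Prop} {π : OrientedLine → X} {C : Set X}
  {P : Set (Set X)}

theorem IsLineQuotient.exists_incident (hπ : IsLineQuotient Inc π) (x : X) : ∃ p, Inc p x := by
  obtain ⟨L, rfl⟩ := hπ.surjective x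
  exact L.exists_incident.imp fun p => (hπ.incident_iff p L).2

theorem IsLineQuotient.incident_smul_iff (hπ : IsLineQuotient Inc π) (g : GL4) (p : Point)
    (x : X) : Inc (g • p) (g • x) ↔ Inc p x := by
  obtain ⟨L, rfl⟩ := hπ.surjective x
  rw [← hπ.map_smul, hπ.incident_iff, hπ.incident_iff]
  exact Line.incident_smul_iff g p L.line

theorem IsSpread.smul (hC : IsSpread Inc C) (hπ : IsLineQuotient Inc π) (g : GL4) :
    IsSpread Inc (g • C) := by
  intro p
  have hinc (x : X) : Inc p (g • x) ↔ Inc (g⁻¹ • p) x := by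
    rw [← hπ.incident_smul_iff g (g⁻¹ • p), smul_inv_smul]
  simpa only [existsUnique_mem_smul_set_iff, hinc] using hC (g⁻¹ • p)

theorem IsParallelism.smul (hP : IsParallelism Inc P) (hπ : IsLineQuotient Inc π) (g : GL4) :
    IsParallelism Inc (g • P) where
  isSpread := by
    rintro _ ⟨C, hC, rfl⟩
    exact (hP.isSpread C hC).smul hπ g
  existsUnique_mem x := by
    rw [existsUnique_mem_smul_set_iff]
    simpa only [Set.mem_smul_set_iff_inv_smul_mem] using hP.existsUnique_mem (g⁻¹ • x)

theorem IsLineQuotient.mem_orbit_leftFactor_iff (hπ : IsLineQuotient Inc π) {x : X}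
    {L : OrientedLine} :
    x ∈ MulAction.orbit leftFactor (π L) ↔ ∃ N, π N = x ∧ N.axis = L.axis := by
  constructor
  · rintro ⟨⟨h, hh⟩, rfl⟩
    exact ⟨h • L, hπ.map_smul h L, OrientedLine.axis_smul_of_mem_leftFactor hh L⟩
  · rintro ⟨N, rfl, hN⟩
    obtain ⟨p, hp⟩ := L.exists_incident
    obtain ⟨p', hp'⟩ := N.exists_incident
    obtain ⟨h, hh, rfl⟩ := exists_mem_leftFactor_smul_eq p p'
    refine ⟨⟨h, hh⟩, (hπ.map_smul h L).symm.trans (congrArg π ?_)⟩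
    refine OrientedLine.eq_of_axis_eq_of_incident ((Line.incident_smul_iff h p L.line).2 hp) hp' ?_
    rw [OrientedLine.axis_smul_of_mem_leftFactor hh, hN]

theorem IsLineQuotient.isSpread_orbit_leftFactor (hπ : IsLineQuotient Inc π) (x : X) :
    IsSpread Inc (MulAction.orbit leftFactor x) := by
  intro p
  obtain ⟨p', hp'⟩ := hπ.exists_incident x
  obtain ⟨h, hh, rfl⟩ := exists_mem_leftFactor_smul_eq p' p
  refine existsUnique_of_exists_of_unique
    ⟨h • x, ⟨⟨h, hh⟩, rfl⟩, (hπ.incident_smul_iff h p' x).2 hp'⟩ ?_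
  rintro y z ⟨hy, hpy⟩ ⟨hz, hpz⟩
  obtain ⟨L, rfl⟩ := hπ.surjective x
  obtain ⟨M, rfl, hM⟩ := hπ.mem_orbit_leftFactor_iff.1 hy
  obtain ⟨N, rfl, hN⟩ := hπ.mem_orbit_leftFactor_iff.1 hz
  rw [OrientedLine.eq_of_axis_eq_of_incident ((hπ.incident_iff _ M).1 hpy)
    ((hπ.incident_iff _ N).1 hpz) (hM.trans hN.symm)]

theorem transitiveOnClasses_leftClifford (hπ : IsLineQuotient Inc π) :
    TransitiveOnClasses rightFactor (leftClifford X) := by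
  rintro _ ⟨x, rfl⟩ _ ⟨y, rfl⟩
  obtain ⟨L, rfl⟩ := hπ.surjective x
  obtain ⟨N, rfl⟩ := hπ.surjective y
  obtain ⟨h, hh, hhL⟩ := L.exists_mem_rightFactor_axis_smul_eq N
  refine ⟨h, hh, (smul_orbit_leftFactor hh (π L)).trans (MulAction.orbit_eq_iff.2 ?_)⟩
  exact hπ.mem_orbit_leftFactor_iff.2 ⟨h • L, hπ.map_smul h L, hhL⟩

/-- The axes of any two oriented lines over members of `C` commute, that is, they agree up to
sign. -/
def CommutingAxes (π : OrientedLine → X) (C : Set X) : Prop :=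
  ∀ L N, π L ∈ C → π N ∈ C → Commute L.axis N.axis

/-- The members of `C` can be oriented in such a way that they all have the same axis. -/
def HasCommonAxis (π : OrientedLine → X) (C : Set X) : Prop :=
  ∃ b, ∀ x ∈ C, ∃ L, π L = x ∧ L.axis = b

theorem CommutingAxes.hasCommonAxis_line {C : Set Line} (hC : CommutingAxes OrientedLine.line C) :
    HasCommonAxis OrientedLine.line C := by
  rcases C.eq_empty_or_nonempty with rfl | ⟨x, hx⟩
  · exact ⟨0, fun _ h => h.elim⟩
  obtain ⟨L, rfl⟩ := isLineQuotient_line.surjective x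
  refine ⟨L.axis, fun y hy => ?_⟩
  obtain ⟨N, rfl⟩ := isLineQuotient_line.surjective y
  rcases eq_or_eq_neg_of_commute N.axis_mul_self L.axis_mul_self (hC N L hy hx) with h | h
  · exact ⟨N, rfl, h⟩
  · exact ⟨N.reverse, rfl, by rw [N.axis_reverse, h, neg_neg]⟩

theorem CommutingAxes.hasCommonAxis_id {C : Set OrientedLine} (hC : CommutingAxes id C)
    (hconn : IsPreconnected C) : HasCommonAxis id C := by
  rcases C.eq_empty_or_nonempty with rfl | ⟨L, hL⟩
  · exact ⟨0, fun _ h => h.elim⟩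
  · exact ⟨L.axis, fun N hN => ⟨N, rfl, OrientedLine.axis_eq_of_isPreconnected hconn
      (fun M hM M' hM' => hC M M' hM hM') hL hN⟩⟩

theorem IsSpread.eq_orbit_leftFactor (hC : IsSpread Inc C) (hπ : IsLineQuotient Inc π)
    (haxis : HasCommonAxis π C) {x : X} (hx : x ∈ C) : C = MulAction.orbit leftFactor x := by
  refine eq_of_subset_of_existsUnique (fun y hy => ?_) (fun y _ => hπ.exists_incident y)
    (fun p => (hC p).exists) (hπ.isSpread_orbit_leftFactor x)
  obtain ⟨b, hb⟩ := haxis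
  obtain ⟨L, rfl, hL⟩ := hb x hx
  obtain ⟨N, rfl, hN⟩ := hb y hy
  exact hπ.mem_orbit_leftFactor_iff.2 ⟨N, rfl, hN.trans hL.symm⟩

theorem IsSpread.eq_orbit_rightFactor (hC : IsSpread Inc C) (hπ : IsLineQuotient Inc π)
    (hstab : rightFactor ≤ MulAction.stabilizer GL4 C) {x : X} (hx : x ∈ C) :
    C = MulAction.orbit rightFactor x := by
  symm
  refine eq_of_subset_of_existsUnique ?_ (fun y _ => hπ.exists_incident y) (fun p => ?_) hC
  · rintro _ ⟨⟨h, hh⟩, rfl⟩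
    exact (show h • C = C from hstab hh) ▸ Set.smul_mem_smul_set hx
  · obtain ⟨p', hp'⟩ := hπ.exists_incident x
    obtain ⟨h, hh, rfl⟩ := exists_mem_rightFactor_smul_eq p' p
    exact ⟨h • x, ⟨⟨h, hh⟩, rfl⟩, (hπ.incident_smul_iff h p' x).2 hp'⟩

theorem IsParallelism.rightFactor_le_stabilizer (hP : IsParallelism Inc P)
    (hπ : IsLineQuotient Inc π) (haut : rightFactor ≤ aut P) (hC : C ∈ P)
    (hncomm : ¬CommutingAxes π C) : rightFactor ≤ MulAction.stabilizer GL4 C := by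
  have hcentralizer (L : OrientedLine) (hL : π L ∈ C) (r : Metric.sphere (0 : ℍ[ℝ]) 1)
      (hr : Commute (r : ℍ[ℝ]) L.axis) :
      r ∈ (MulAction.stabilizer GL4 C).comap rightMulHom := by
    have hfix : rightMulHom r • π L = π L := by
      rw [← hπ.map_smul, rightMulHom_smul_eq_self hr]
    exact hP.eq_of_mem (smul_mem_of_le_aut haut (range_rightMulHom ▸ ⟨r, rfl⟩) hC) hC
      (Set.smul_mem_smul_set hL) (hfix.symm ▸ hL)
  simp only [CommutingAxes, not_forall] at hncomm
  obtain ⟨L, N, hL, hN, hLN⟩ := hncomm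
  rw [← range_rightMulHom, MonoidHom.range_eq_map, Subgroup.map_le_iff_le_comap,
    eq_top_of_centralizers_le L.axis_mul_self N.axis_mul_self hLN (hcentralizer L hL)
      (hcentralizer N hN)]

theorem IsParallelism.eq_range_orbit (hP : IsParallelism Inc P) {H : Subgroup GL4}
    (horbit : ∀ x, MulAction.orbit H x ∈ P) : P = Set.range fun x : X => MulAction.orbit H x := by
  symm
  refine eq_of_subset_of_existsUnique (Set.range_subset_iff.2 horbit) (fun C hC => ?_)
    (fun x => ⟨_, ⟨x, rfl⟩, MulAction.mem_orbit_self x⟩) hP.existsUnique_mem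
  obtain ⟨x, ⟨hx, -⟩, -⟩ := hP.isSpread C hC (Projectivization.mk ℝ 1 one_ne_zero)
  exact ⟨x, hx⟩

theorem IsParallelism.eq_leftClifford (hP : IsParallelism Inc P) (hπ : IsLineQuotient Inc π)
    (haut : rightFactor ≤ aut P) {x : X} (hx : MulAction.orbit leftFactor x ∈ P) :
    P = leftClifford X := by
  refine hP.eq_range_orbit fun y => ?_
  obtain ⟨h, hh, hxy⟩ := transitiveOnClasses_leftClifford hπ _ ⟨x, rfl⟩ _ ⟨y, rfl⟩
  exact (show h • _ = MulAction.orbit leftFactor y from hxy) ▸ smul_mem_of_le_aut haut hh hx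

theorem IsParallelism.eq_rightClifford_or_eq_leftClifford (hP : IsParallelism Inc P)
    (hπ : IsLineQuotient Inc π) (haxis : ∀ C ∈ P, CommutingAxes π C → HasCommonAxis π C)
    (haut : rightFactor ≤ aut P) : P = rightClifford X ∨ P = leftClifford X := by
  by_cases hcomm : ∃ C ∈ P, CommutingAxes π C
  · obtain ⟨C, hC, hCcomm⟩ := hcomm
    obtain ⟨x, ⟨hx, -⟩, -⟩ := hP.isSpread C hC (Projectivization.mk ℝ 1 one_ne_zero)
    refine Or.inr (hP.eq_leftClifford hπ haut (x := x) ?_)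
    rwa [← (hP.isSpread C hC).eq_orbit_leftFactor hπ (haxis C hC hCcomm) hx]
  · refine Or.inl (hP.eq_range_orbit fun x => ?_)
    obtain ⟨C, ⟨hC, hx⟩, -⟩ := hP.existsUnique_mem x
    rwa [← (hP.isSpread C hC).eq_orbit_rightFactor hπ
      (hP.rightFactor_le_stabilizer hπ haut hC fun h => hcomm ⟨C, hC, h⟩) hx]

theorem IsParallelism.fixesClasses_or_transitiveOnClasses (hP : IsParallelism Inc P)
    (hπ : IsLineQuotient Inc π)
    (haxis : ∀ g : GL4, ∀ C ∈ P, CommutingAxes π (g • C) → HasCommonAxis π (g • C)) (g : GL4)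
    (haut : MulAut.conj g • rightFactor ≤ aut P) :
    (FixesClasses (MulAut.conj g • rightFactor) P ∧ P = g • rightClifford X) ∨
      (TransitiveOnClasses (MulAut.conj g • rightFactor) P ∧ P = g • leftClifford X) := by
  refine ((hP.smul hπ g⁻¹).eq_rightClifford_or_eq_leftClifford hπ
    (Set.forall_mem_image.2 (haxis g⁻¹)) (le_aut_inv_smul haut)).imp (fun h => ?_) fun h => ?_
  · obtain rfl := inv_smul_eq_iff.1 h
    exact ⟨(fixesClasses_rightClifford X).smul g, rfl⟩
  · obtain rfl := inv_smul_eq_iff.1 h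
    exact ⟨(transitiveOnClasses_leftClifford hπ).smul g, rfl⟩

end Classification

/-- The conclusion of the classification for the conjugates under `g` of both factors: whichever of
them leaves `P` invariant, `P` is the image under `g` of a Clifford parallelism, which one depending
on whether the group fixes the members of `P` or permutes them transitively. -/
def CliffordAlternative {X : Type} [MulAction GL4 X] (g : GL4) (P : Set (Set X)) : Prop :=
  (MulAut.conj g • rightFactor ≤ aut P →
    (FixesClasses (MulAut.conj g • rightFactor) P ∧ P = g • rightClifford X) ∨
    (TransitiveOnClasses (MulAut.conj g • rightFactor) P ∧ P = g • leftClifford X)) ∧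
  (MulAut.conj g • leftFactor ≤ aut P →
    (FixesClasses (MulAut.conj g • leftFactor) P ∧ P = g • leftClifford X) ∨
    (TransitiveOnClasses (MulAut.conj g • leftFactor) P ∧ P = g • rightClifford X))

theorem IsParallelism.cliffordAlternative {X : Type} [MulAction GL4 X] {Inc : Point → X → Prop}
    {π : OrientedLine → X} {P : Set (Set X)} (hP : IsParallelism Inc P)
    (hπ : IsLineQuotient Inc π)
    (haxis : ∀ g : GL4, ∀ C ∈ P, CommutingAxes π (g • C) → HasCommonAxis π (g • C)) (g : GL4) :
    CliffordAlternative g P := by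
  refine ⟨hP.fixesClasses_or_transitiveOnClasses hπ haxis g, ?_⟩
  have hstar := hP.fixesClasses_or_transitiveOnClasses hπ haxis (g * starEquiv)
  simp only [map_mul, mul_smul, conj_starEquiv_smul_rightFactor, starEquiv_smul_rightClifford,
    starEquiv_smul_leftClifford] at hstar
  exact hstar

end RealParallelism

end

theorem mainTheorem2_general (g : GL4) :
    (∀ P, IsParallelism Line.Incident P → CliffordAlternative g P) ∧
      ∀ P, IsParallelism OrientedLine.Incident P → (∀ C ∈ P, IsPreconnected C) →
        CliffordAlternative g P := by
  refine ⟨fun P hP => hP.cliffordAlternative isLineQuotient_line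
    (fun _ _ _ hcomm => hcomm.hasCommonAxis_line) g, fun P hP hconn => ?_⟩
  refine hP.cliffordAlternative isLineQuotient_id (fun k C hC hcomm => ?_) g
  exact hcomm.hasCommonAxis_id
    ((hconn C hC).image _ (OrientedLine.continuous_smul k).continuousOn)

theorem mainTheorem2 (g : GL4) :
    (∀ P : Set (Set Line), IsOrdinaryParallelism P →
      (MulAut.conj g • rightFactor ≤ aut P →
        (FixesClasses (MulAut.conj g • rightFactor) P ∧
            P = g • rightClifford Line) ∨
        (TransitiveOnClasses (MulAut.conj g • rightFactor) P ∧
            P = g • leftClifford Line)) ∧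
      (MulAut.conj g • leftFactor ≤ aut P →
        (FixesClasses (MulAut.conj g • leftFactor) P ∧
            P = g • leftClifford Line) ∨
        (TransitiveOnClasses (MulAut.conj g • leftFactor) P ∧
            P = g • rightClifford Line))) ∧
    (∀ P : Set (Set OrientedLine), IsOrientedParallelism P →
      (MulAut.conj g • rightFactor ≤ aut P →
        (FixesClasses (MulAut.conj g • rightFactor) P ∧
            P = g • rightClifford OrientedLine) ∨
        (TransitiveOnClasses (MulAut.conj g • rightFactor) P ∧
            P = g • leftClifford OrientedLine)) ∧
      (MulAut.conj g • leftFactor ≤ aut P →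
        (FixesClasses (MulAut.conj g • leftFactor) P ∧
            P = g • leftClifford OrientedLine) ∨
        (TransitiveOnClasses (MulAut.conj g • leftFactor) P ∧
            P = g • rightClifford OrientedLine))) :=
  ⟨fun P hP => (mainTheorem2_general g).1 P hP.isParallelism, fun P hP =>
    (mainTheorem2_general g).2 P hP.isParallelism fun C hC => (hP.1 C hC).2.1.isPreconnected⟩
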